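/- For complex $x$, $q$ and integers $n\ge 0$ write $(x;q)_n=\prod_{i=0}^{n-1}(1-xq^i)$ and $(x_1,x_2;q)_n=(x_1;q)_n(x_2;q)_n$. For parameters $a\neq 0$, $k$, $q$, a pair of complex sequences $(\alpha_n(a,k,q),\beta_n(a,k,q))_{n\ge 0}$ is called a WP-Bailey pair if $\alpha_0(a,k,q)=\beta_0(a,k,q)=1$ and, for $n>0$, $$\beta_n(a,k,q)=\sum_{j=0}^{n}\frac{(k/a;q)_{n-j}(k;q)_{n+j}}{(q;q)_{n-j}(aq;q)_{n+j}}\,\alpha_j(a,k,q).$$ **Theorem.** Let $a,k,z,q\in\mathbb{C}$ with $|q|<1$, $a\ne 0$, $z\neq 0$, $kq^n\neq\pm1$ for all $n\ge 0$, and $aq^n\ne\pm 1$, $kq^n/z\neq\pm1$, $aq^n/z\ne\pm1$ for all $n\ge 1$ (so that no denominator below vanishes). Let $(\alpha_n,\beta_n)$ be a WP-Bailey pair at each of the parameter triples $(a,k,q)$, $(-a,-k,q)$, $(a^2,k^2,q^2)$, and suppose that the six series below converge absolutely. Then $$\sum_{n=1}^{\infty} \frac{(1-k q^{2n})(z;q)_{n}(q;q)_{n-1}}{(1-k)(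 q k,q k/z;q)_{n}}\left( \frac{q a}{ z }\right )^{n} \beta_n(a,k,q) +\sum_{n=1}^{\infty} \frac{(1+k q^{2n})(z;q)_{n}(q;q)_{n-1}}{(1+k)( -q k,-q k/z;q)_{n}}\left( \frac{-q a}{ z }\right )^{n}\beta_n(-a,-k,q)$$ $$-2 \sum_{n=1}^{\infty} \frac{(1-k^2q^{4n})(z^2;q^2)_{n}(q^2;q^2)_{n-1}} {(1-k^2)( q^2 k^2,q^2k^2/z^2;q^2)_{n}}\left( \frac{q^2 a^2}{ z^2 }\right )^{n}\beta_n(a^2,k^2,q^2)$$ $$=\sum_{n=1}^{\infty}\frac{(z;q)_{n}(q;q)_{n-1}}{(q a ,qa/z;q)_n}\left (\frac{q a}{z}\right)^{n}\alpha_n(a,k,q) +\sum_{n=1}^{\infty}\frac{(z;q)_{n}(q;q)_{n-1}}{(-q a ,-qa/z;q)_n}\left (\frac{-q a}{z}\right)^{n}\alpha_n(-a,-k,q)$$ $$-2\sum_{n=1}^{\infty}\frac{(z^2;q^2)_{n}(q^2;q^2)_{n-1}}{(q^2 a^2 ,q^2a^2/z^2;q^2)_n}\left (\frac{q^2a^2}{z^2}\right)^{n}\alpha_n(a^2,k^2,q^2).$$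 -/

import Mathlib

/-- The finite `q`-shifted factorial `(a; q)_n = (1 - a)(1 - a q) ⋯ (1 - a q ^ (n - 1))`. -/
noncomputable def qPoch (a q : ℂ) (n : ℕ) : ℂ :=
  ∏ i ∈ Finset.range n, (1 - a * q ^ i)

/-- The sequences `α`, `β` form a WP-Bailey pair at the parameters `(a, k, q)`. -/
def IsWPBaileyPair (a k q : ℂ) (α β : ℕ → ℂ) : Prop :=
  α 0 = 1 ∧ β 0 = 1 ∧
    ∀ n : ℕ, 0 < n →
      β n = ∑ j ∈ Finset.range (n + 1),
        qPoch (k / a) q (n - j) * qPoch k q (n + j) /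
          (qPoch q q (n - j) * qPoch (a * q) q (n + j)) * α j

/-- The `n`-th term (`n ≥ 1`) of the `β`-weighted series at the parameters `(a, k, z, q)`:
`(1 - k q^{2n}) (z; q)_n (q; q)_{n-1} / ((1 - k) (q k, q k / z; q)_n) (q a / z)^n β_n`. -/
noncomputable def betaTerm (a k z q : ℂ) (β : ℕ → ℂ) (n : ℕ) : ℂ :=
  (1 - k * q ^ (2 * n)) * qPoch z q n * qPoch q q (n - 1) /
    ((1 - k) * (qPoch (q * k) q n * qPoch (q * k / z) q n)) * (q * a / z) ^ n * β n

/-- The `n`-th term (`n ≥ 1`) of the `α`-weighted series at the parameters `(a, z, q)`: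
`(z; q)_n (q; q)_{n-1} / (q a, q a / z; q)_n (q a / z)^n α_n`. -/
noncomputable def alphaTerm (a z q : ℂ) (α : ℕ → ℂ) (n : ℕ) : ℂ :=
  qPoch z q n * qPoch q q (n - 1) /
    (qPoch (q * a) q n * qPoch (q * a / z) q n) * (q * a / z) ^ n * α n

/-!
Inserting the Bailey relation into the `β`-series and exchanging the order of summation would leave
very-well-poised inner sums, but the resulting double series need not converge absolutely. Both
series are therefore damped by normalized WP-Bailey kernels `kernelRatio`. The damped sums are
finite and their inner sums terminate, so Jackson's `₈φ₇` sum evaluates them and gives an exact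
identity for every truncation `N`. The kernels are uniformly bounded and tend to `1`, so dominated
convergence turns this into an identity between the two series. The index `j = 0` contributes the
degenerate case `c = 1` of Jackson's sum, divided by `1 - c`, which is a combination of Lambert
series `L(x; q) = ∑ x q ^ i / (1 - x q ^ i)`. In the theorem these cancel, because
`L(x; q) + L(-x; q) = 2 L(x²; q²)`.
-/

open Filter Topology

theorem qPoch_zero (x q : ℂ) : qPoch x q 0 = 1 :=
  Finset.prod_range_zero _

theorem qPoch_succ (x q : ℂ) (n : ℕ) : qPoch x q (n + 1) = qPoch x q n * (1 - x * q ^ n) :=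
  Finset.prod_range_succ _ _

theorem qPoch_add (x q : ℂ) (m n : ℕ) :
    qPoch x q (m + n) = qPoch x q m * qPoch (x * q ^ m) q n := by
  simp only [qPoch, Finset.prod_range_add, pow_add, mul_assoc]

theorem qPoch_succ' (x q : ℂ) (n : ℕ) :
    qPoch x q (n + 1) = (1 - x) * qPoch (x * q) q n := by
  rw [add_comm, qPoch_add, qPoch_succ, qPoch_zero, pow_zero, pow_one, one_mul, mul_one]

theorem qPoch_ne_zero {x q : ℂ} (h : ∀ i, 1 - x * q ^ i ≠ 0) (n : ℕ) : qPoch x q n ≠ 0 :=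
  Finset.prod_ne_zero_iff.2 fun i _ => h i

/-- The kernel `(ua/a; q)_{N-n} (ua; q)_{N+n} / ((q; q)_{N-n} (aq; q)_{N+n})` of WP-Bailey pairs
at the parameters `(a, ua)`, divided by its value at `n = 0`. The quotient
`(ua; q)_{N+n} / (ua; q)_N` is written as `(u a q ^ N; q)_n`, so that it makes sense even where
`(ua; q)_N = 0`. -/
noncomputable def kernelRatio (a u q : ℂ) (N n : ℕ) : ℂ :=
  qPoch q q N * qPoch u q (N - n) * qPoch (a * q) q N * qPoch (u * a * q ^ N) q n /
    (qPoch q q (N - n) * qPoch u q N * qPoch (a * q) q (N + n))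

/-- The part of the summand of Jackson's sum that does not depend on the length of the sum. -/
noncomputable def jacksonCoeff (a b c d u q : ℂ) (m : ℕ) : ℂ :=
  qPoch (a * q) q m * qPoch b q (m + 1) * qPoch (c * q) q m * qPoch d q (m + 1) /
    (qPoch q q (m + 1) * qPoch (c * d * u) q (m + 1) * qPoch (b * d * u) q (m + 1) *
      qPoch (b * c * u) q (m + 1)) * u ^ (m + 1)

/-- The summand of index `m + 1` of Jackson's terminating very-well-poised sum `₈φ₇`, in the
balanced case `a q = b c d u`, divided by `1 - c`; this makes the case `c = 1` meaningful. -/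
noncomputable def jacksonTerm (a b c d u q : ℂ) (M m : ℕ) : ℂ :=
  (1 - a * q ^ (2 * (m + 1))) * jacksonCoeff a b c d u q m * kernelRatio a u q M (m + 1)

/-- The factor of the WZ companion of `jacksonTerm` that corresponds to `kernelRatio`. -/
noncomputable def jacksonCertKernel (a u q : ℂ) (M m : ℕ) : ℂ :=
  qPoch q q M * qPoch u q (M - m) * qPoch (a * q) q (M + 1) * qPoch (u * a * q ^ (M + 1)) q m /
    (qPoch q q (M - m) * qPoch u q M * qPoch (a * q) q (M + 1 + m))

/-- The WZ companion of `jacksonTerm`: its differences in `m` telescope in the recursion for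
Jackson's sum in the length `M`. -/
noncomputable def jacksonCert (a b c d u q : ℂ) (M m : ℕ) : ℂ :=
  q ^ (M - m) * (1 - u * a * q ^ (2 * M + 1)) *
    ((1 - q * q ^ m) * (1 - c * d * u * q ^ m) * (1 - b * d * u * q ^ m) *
      (1 - b * c * u * q ^ m) * jacksonCoeff a b c d u q m) * jacksonCertKernel a u q M m

/-- The parameters `a, b, c, d, u` of a balanced Jackson sum to base `q`, none of whose
denominators vanishes. -/
structure JacksonAdmissible (a b c d u q : ℂ) : Prop where
  balanced : a * q = b * c * d * u
  base_ne_zero : ∀ i, 1 - q * q ^ i ≠ 0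
  shift_ne_zero : ∀ i, 1 - a * q * q ^ i ≠ 0
  arg_ne_zero : ∀ i, 1 - u * q ^ i ≠ 0
  bc_ne_zero : ∀ i, 1 - b * c * u * q ^ i ≠ 0
  bd_ne_zero : ∀ i, 1 - b * d * u * q ^ i ≠ 0
  cd_ne_zero : ∀ i, 1 - c * d * u * q ^ i ≠ 0

/-- The `i`-th term of the Lambert series `∑ x q ^ i / (1 - x q ^ i)`. -/
noncomputable def lambertTerm (x q : ℂ) (i : ℕ) : ℂ :=
  x * q ^ i / (1 - x * q ^ i)

section Jackson

variable {a b c d u q : ℂ}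

theorem kernelRatio_succ_succ (hu : ∀ i, 1 - u * q ^ i ≠ 0) (haq : ∀ i, 1 - a * q * q ^ i ≠ 0)
    (M m : ℕ) :
    kernelRatio a u q (M + 1) (m + 1) * ((1 - u * q ^ M) * (1 - a * q * q ^ (M + 1 + m))) =
      jacksonCertKernel a u q M m *
        ((1 - q * q ^ M) * (1 - u * a * q ^ (M + 1) * q ^ m)) := by
  have hu_top := hu M
  have haq_top := haq (M + 1 + m)
  simp only [kernelRatio, jacksonCertKernel, Nat.add_sub_add_right, ← add_assoc, qPoch_succ _ _ M,
    qPoch_succ _ _ m, qPoch_succ _ _ (M + 1 + m)]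
  generalize 1 - u * q ^ M = x, 1 - a * q * q ^ (M + 1 + m) = y at *
  field_simp

theorem kernelRatio_succ (hq : ∀ i, 1 - q * q ^ i ≠ 0) (hu : ∀ i, 1 - u * q ^ i ≠ 0)
    (haq : ∀ i, 1 - a * q * q ^ i ≠ 0) (m l : ℕ) :
    kernelRatio a u q (m + 1 + l) (m + 1) *
        ((1 - u * q ^ l) * (1 - a * q * q ^ (m + 1 + l))) =
      jacksonCertKernel a u q (m + 1 + l) m *
        ((1 - q * q ^ l) * (1 - u * a * q ^ (m + 1 + l))) := by
  have hu_l := hu l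
  have haq_top := haq (m + 1 + l)
  have hq_l := hq l
  have hshift : qPoch (u * a * q ^ (m + 1 + l)) q (m + 1) =
      qPoch (u * a * q ^ (m + 1 + l + 1)) q m * (1 - u * a * q ^ (m + 1 + l)) := by
    rw [add_comm m 1, qPoch_add, qPoch, Finset.prod_range_one]
    ring_nf
  simp only [kernelRatio, jacksonCertKernel, hshift, show m + 1 + l - (m + 1) = l by omega,
    show m + 1 + l - m = l + 1 by omega, show m + 1 + l + (m + 1) = m + 1 + l + 1 + m by omega,
    qPoch_succ _ _ l, qPoch_succ _ _ (m + 1 + l)]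
  field_simp

theorem jacksonCertKernel_succ (hq : ∀ i, 1 - q * q ^ i ≠ 0) (hu : ∀ i, 1 - u * q ^ i ≠ 0)
    (haq : ∀ i, 1 - a * q * q ^ i ≠ 0) (m l : ℕ) :
    jacksonCertKernel a u q (m + 1 + l) (m + 1) *
        ((1 - u * q ^ l) * (1 - a * q * q ^ (m + 1 + l + 1 + m))) =
      jacksonCertKernel a u q (m + 1 + l) m *
        ((1 - q * q ^ l) * (1 - u * a * q ^ (m + 1 + l + 1) * q ^ m)) := by
  have hu_l := hu l
  have haq_top := haq (m + 1 + l + 1 + m)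
  have hq_l := hq l
  simp only [jacksonCertKernel, show m + 1 + l - (m + 1) = l by omega,
    show m + 1 + l - m = l + 1 by omega, ← add_assoc, qPoch_succ _ _ l, qPoch_succ _ _ m,
    qPoch_succ _ _ (m + 1 + l + 1 + m)]
  field_simp

theorem jacksonCoeff_succ (hq : ∀ i, 1 - q * q ^ i ≠ 0) (hcd : ∀ i, 1 - c * d * u * q ^ i ≠ 0)
    (hbd : ∀ i, 1 - b * d * u * q ^ i ≠ 0) (hbc : ∀ i, 1 - b * c * u * q ^ i ≠ 0) (m : ℕ) :
    (1 - q * q ^ (m + 1)) * (1 - c * d * u * q ^ (m + 1)) * (1 - b * d * u * q ^ (m + 1)) *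
        (1 - b * c * u * q ^ (m + 1)) * jacksonCoeff a b c d u q (m + 1) =
      (1 - a * q * q ^ m) * (1 - b * q ^ (m + 1)) * (1 - c * q * q ^ m) *
        (1 - d * q ^ (m + 1)) * u * jacksonCoeff a b c d u q m := by
  have h := mul_ne_zero (mul_ne_zero (mul_ne_zero (hq (m + 1)) (hcd (m + 1))) (hbd (m + 1)))
    (hbc (m + 1))
  rw [jacksonCoeff, jacksonCoeff, div_mul_eq_mul_div, mul_div_assoc', div_mul_eq_mul_div,
    mul_div_assoc', ← mul_div_mul_left _ (qPoch q q (m + 1) * _ * _ * _) h]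
  simp only [qPoch_succ _ _ (m + 1), qPoch_succ (a * q) q m, qPoch_succ (c * q) q m]
  congr 1 <;> ring

theorem jackson_wz_identity {R : Type*} [CommRing R] (b c d u q p r : R) {y : R}
    (hy : y = u * (p * q * r)) :
    (1 - b * c * d * u * q * p ^ 2) *
        ((1 - q * (p * q * r)) * (1 - b * c * d * u * p * y) * (1 - u * r) *
            ((1 - b * c * y) * (1 - b * d * y) * (1 - c * d * y)) -
          (1 - b * y) * (1 - c * y) * (1 - d * y) * (1 - q * r) *
            (1 - u * (b * c * d * u * (p * r))) * (1 - b * c * d * u * (p * q * r * q * p))) =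
      (1 - b * c * d * y ^ 2) *
        (r * q * ((1 - q * p) * (1 - c * d * u * p) * (1 - b * d * u * p) * (1 - b * c * u * p)) *
            ((1 - u * r) * (1 - b * c * d * u * (p * q * r * q * p))) -
          r * ((1 - b * c * d * u * p) * (1 - b * (p * q)) * (1 - c * q * p) * (1 - d * (p * q)) *
            u * ((1 - q * r) * (1 - b * c * d * u * p * y)))) := by
  subst hy
  ring

theorem jacksonTerm_succ_mul (h : JacksonAdmissible a b c d u q) (m l : ℕ) {y : ℂ}
    (hy : y = u * q ^ (m + 1 + l)) :
    (1 - y) * (1 - b * c * y) * (1 - b * d * y) * (1 - c * d * y) *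
        jacksonTerm a b c d u q (m + 1 + l + 1) m =
      (1 - b * c * d * y) * (1 - b * y) * (1 - c * y) * (1 - d * y) *
          jacksonTerm a b c d u q (m + 1 + l) m +
        jacksonCert a b c d u q (m + 1 + l) m - jacksonCert a b c d u q (m + 1 + l) (m + 1) := by
  have ha_even : a * q ^ (2 * (m + 1)) = b * c * d * u * q * (q ^ m) ^ 2 := by
    rw [← h.balanced]; ring
  have hua_odd : u * a * q ^ (2 * (m + 1 + l) + 1) = b * c * d * y ^ 2 := by
    rw [hy]; linear_combination u * q ^ (2 * (m + 1 + l)) * h.balanced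
  have hua_add : u * a * q ^ (m + 1 + l + 1) * q ^ m = b * c * d * u * q ^ m * y := by
    rw [hy, ← h.balanced]; ring
  have haq_top : a * q * q ^ (m + 1 + l) = b * c * d * y := by rw [hy, h.balanced]; ring
  have hua_top : u * a * q ^ (m + 1 + l) = u * (b * c * d * u * (q ^ m * q ^ l)) := by
    rw [← h.balanced]; ring
  have haq_add : a * q * q ^ (m + 1 + l + 1 + m) =
      b * c * d * u * (q ^ m * q * q ^ l * q * q ^ m) := by rw [h.balanced]; ring
  have hterm₁ := kernelRatio_succ_succ h.arg_ne_zero h.shift_ne_zero (m + 1 + l) m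
  have hterm₂ := kernelRatio_succ h.base_ne_zero h.arg_ne_zero h.shift_ne_zero m l
  have hcert := jacksonCertKernel_succ h.base_ne_zero h.arg_ne_zero h.shift_ne_zero m l
  have hne := mul_ne_zero (h.arg_ne_zero l) (h.shift_ne_zero (m + 1 + l + 1 + m))
  have hwz := jackson_wz_identity b c d u q (q ^ m) (q ^ l) (hy.trans (by ring))
  rw [jacksonTerm, jacksonTerm, jacksonCert, jacksonCert,
    jacksonCoeff_succ h.base_ne_zero h.cd_ne_zero h.bd_ne_zero h.bc_ne_zero m, ha_even,
    hua_odd, h.balanced, show m + 1 + l - m = l + 1 by omega,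
    show m + 1 + l - (m + 1) = l by omega]
  rw [hua_add, haq_add, ← hy] at hterm₁
  rw [haq_top, hua_top] at hterm₂
  rw [hua_add, haq_add] at hcert
  rw [haq_add] at hne
  refine mul_left_cancel₀ hne ?_
  linear_combination
    (1 - b * c * d * u * q * (q ^ m) ^ 2) * jacksonCoeff a b c d u q m *
      ((1 - b * c * y) * (1 - b * d * y) * (1 - c * d * y) * (1 - u * q ^ l) * hterm₁ -
        (1 - b * y) * (1 - c * y) * (1 - d * y) *
          (1 - b * c * d * u * (q ^ m * q * q ^ l * q * q ^ m)) * hterm₂) +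
    q ^ l * (1 - b * c * d * y ^ 2) * ((1 - b * c * d * u * q ^ m) * (1 - b * q ^ (m + 1)) *
      (1 - c * q * q ^ m) * (1 - d * q ^ (m + 1)) * u * jacksonCoeff a b c d u q m) * hcert +
    jacksonCoeff a b c d u q m * jacksonCertKernel a u q (m + 1 + l) m * hwz

theorem jacksonTerm_succ_self_mul (hu : ∀ i, 1 - u * q ^ i ≠ 0)
    (haq : ∀ i, 1 - a * q * q ^ i ≠ 0) (M : ℕ) {y : ℂ} (hy : y = u * q ^ M) :
    (1 - y) * (1 - b * c * y) * (1 - b * d * y) * (1 - c * d * y) *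
        jacksonTerm a b c d u q (M + 1) M = jacksonCert a b c d u q M M := by
  rw [jacksonTerm, jacksonCert, Nat.sub_self, hy]
  linear_combination (1 - b * c * (u * q ^ M)) * (1 - b * d * (u * q ^ M)) *
    (1 - c * d * (u * q ^ M)) * jacksonCoeff a b c d u q M * kernelRatio_succ_succ hu haq M M

theorem jacksonCert_zero (h : JacksonAdmissible a b c d u q) (M : ℕ) {y : ℂ} (hy : y = u * q ^ M) :
    jacksonCert a b c d u q M 0 = y * (1 - b) * (1 - d) * (1 - b * c * d * y ^ 2) := by
  have hkernel : jacksonCertKernel a u q M 0 = 1 := by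
    rw [jacksonCertKernel, Nat.sub_zero, add_zero, qPoch_zero, mul_one]
    exact div_self (mul_ne_zero (mul_ne_zero (qPoch_ne_zero h.base_ne_zero _)
      (qPoch_ne_zero h.arg_ne_zero _)) (qPoch_ne_zero h.shift_ne_zero _))
  have hcoeff : (1 - q * q ^ 0) * (1 - c * d * u * q ^ 0) * (1 - b * d * u * q ^ 0) *
      (1 - b * c * u * q ^ 0) * jacksonCoeff a b c d u q 0 = (1 - b) * (1 - d) * u := by
    have hne := mul_ne_zero (mul_ne_zero (mul_ne_zero (h.base_ne_zero 0) (h.cd_ne_zero 0))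
      (h.bd_ne_zero 0)) (h.bc_ne_zero 0)
    simp only [jacksonCoeff, qPoch_succ _ _ 0, qPoch_zero, one_mul, mul_one, pow_zero, zero_add,
      pow_one] at hne ⊢
    rw [← mul_assoc, mul_div_cancel₀ _ hne]
  rw [jacksonCert, hkernel, hcoeff, hy, Nat.sub_zero]
  linear_combination -(1 - b) * (1 - d) * u ^ 2 * q ^ (3 * M) * h.balanced

theorem sum_jacksonTerm_succ_mul (h : JacksonAdmissible a b c d u q) (M : ℕ) {y : ℂ}
    (hy : y = u * q ^ M) :
    (1 - y) * (1 - b * c * y) * (1 - b * d * y) * (1 - c * d * y) *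
        ∑ m ∈ Finset.range (M + 1), jacksonTerm a b c d u q (M + 1) m =
      (1 - b * c * d * y) * (1 - b * y) * (1 - c * y) * (1 - d * y) *
          ∑ m ∈ Finset.range M, jacksonTerm a b c d u q M m +
        y * (1 - b) * (1 - d) * (1 - b * c * d * y ^ 2) := by
  rw [Finset.sum_range_succ, mul_add, jacksonTerm_succ_self_mul h.arg_ne_zero h.shift_ne_zero M hy,
    ← jacksonCert_zero h M hy, Finset.mul_sum, Finset.mul_sum]
  rw [← sub_add_cancel (jacksonCert a b c d u q M 0) (jacksonCert a b c d u q M M), ← add_assoc,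
    ← Finset.sum_range_sub', ← Finset.sum_add_distrib]
  congr 1
  refine Finset.sum_congr rfl fun m hm => ?_
  obtain ⟨l, rfl⟩ := Nat.exists_eq_add_of_le (Nat.succ_le_of_lt (Finset.mem_range.1 hm))
  rw [jacksonTerm_succ_mul h m l hy, add_sub_assoc]

theorem one_add_mul_sum_jacksonTerm (h : JacksonAdmissible a b c d u q) (M : ℕ) :
    1 + (1 - c) * ∑ m ∈ Finset.range M, jacksonTerm a b c d u q M m =
      qPoch (b * c * d * u) q M * qPoch (b * u) q M * qPoch (c * u) q M * qPoch (d * u) q M /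
        (qPoch u q M * qPoch (b * c * u) q M * qPoch (b * d * u) q M * qPoch (c * d * u) q M) := by
  rw [eq_div_iff (mul_ne_zero (mul_ne_zero (mul_ne_zero (qPoch_ne_zero h.arg_ne_zero _)
    (qPoch_ne_zero h.bc_ne_zero _)) (qPoch_ne_zero h.bd_ne_zero _)) (qPoch_ne_zero h.cd_ne_zero _))]
  induction M with
  | zero => simp [qPoch]
  | succ M ih =>
    have hrec := sum_jacksonTerm_succ_mul h M rfl
    simp only [qPoch_succ]
    linear_combination (1 - b * c * d * u * q ^ M) * (1 - b * u * q ^ M) * (1 - c * u * q ^ M) *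
      (1 - d * u * q ^ M) * ih + (1 - c) * qPoch u q M * qPoch (b * c * u) q M *
        qPoch (b * d * u) q M * qPoch (c * d * u) q M * hrec

theorem sum_jacksonTerm_one (h : JacksonAdmissible a b 1 d u q) (M : ℕ) :
    ∑ m ∈ Finset.range M, jacksonTerm a b 1 d u q M m =
      ∑ i ∈ Finset.range M, (lambertTerm u q i + lambertTerm (b * d * u) q i -
        lambertTerm (b * u) q i - lambertTerm (d * u) q i) := by
  induction M with
  | zero => rfl
  | succ M ih =>
    have hrec := sum_jacksonTerm_succ_mul h M rfl
    have hu := h.arg_ne_zero M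
    have hcd := h.cd_ne_zero M
    have hbd := h.bd_ne_zero M
    have hbc := h.bc_ne_zero M
    rw [one_mul] at hcd
    rw [mul_one] at hbc
    simp only [mul_one, one_mul, ← mul_assoc] at hrec
    refine mul_left_cancel₀ (mul_ne_zero (mul_ne_zero (mul_ne_zero hu hbc) hbd) hcd) ?_
    rw [hrec, Finset.sum_range_succ, ← ih]
    simp only [lambertTerm]
    field_simp
    ring

end Jackson

/-- The coefficient of `α j` in the relation that expresses `β n` in a WP-Bailey pair. -/
noncomputable def wpKernel (a k q : ℂ) (n j : ℕ) : ℂ :=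
  qPoch (k / a) q (n - j) * qPoch k q (n + j) / (qPoch q q (n - j) * qPoch (a * q) q (n + j))

/-- The factor of `β n` in `betaTerm`. -/
noncomputable def betaWeight (a k z q : ℂ) (n : ℕ) : ℂ :=
  (1 - k * q ^ (2 * n)) * qPoch z q n * qPoch q q (n - 1) /
    ((1 - k) * (qPoch (q * k) q n * qPoch (q * k / z) q n)) * (q * a / z) ^ n

/-- The factor of `α n` in `alphaTerm`. -/
noncomputable def alphaWeight (a z q : ℂ) (n : ℕ) : ℂ :=
  qPoch z q n * qPoch q q (n - 1) / (qPoch (q * a) q n * qPoch (q * a / z) q n) * (q * a / z) ^ n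

/-- The parameters with `|q| < 1` at which no denominator of the WP-Bailey kernel, of `betaTerm`
or of `alphaTerm` vanishes. -/
structure WPAdmissible (a k z q : ℂ) : Prop where
  norm_lt_one : ‖q‖ < 1
  a_ne_zero : a ≠ 0
  z_ne_zero : z ≠ 0
  one_sub_k_ne_zero : ∀ n, 1 - k * q ^ n ≠ 0
  one_sub_a_ne_zero : ∀ n, 1 ≤ n → 1 - a * q ^ n ≠ 0
  one_sub_k_div_ne_zero : ∀ n, 1 ≤ n → 1 - k / z * q ^ n ≠ 0
  one_sub_a_div_ne_zero : ∀ n, 1 ≤ n → 1 - a / z * q ^ n ≠ 0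

theorem one_sub_mul_pow_ne_zero {K : Type*} [NormedDivisionRing K] {q : K} (hq : ‖q‖ < 1) (i : ℕ) :
    1 - q * q ^ i ≠ 0 := by
  rw [← pow_succ']
  exact (sub_ne_zero.2 fun h => (pow_lt_one₀ (norm_nonneg q) hq i.succ_ne_zero).ne
    (by rw [← norm_pow, ← h, norm_one]))

theorem one_sub_shift_ne_zero {R : Type*} [Ring R] {x q : R} (h : ∀ i, 1 - x * q ^ i ≠ 0)
    (n i : ℕ) :
    1 - x * q ^ n * q ^ i ≠ 0 := by
  simpa only [pow_add, mul_assoc] using h (n + i)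

theorem one_sub_base_mul_ne_zero {R : Type*} [CommRing R] {x q : R}
    (h : ∀ n, 1 ≤ n → 1 - x * q ^ n ≠ 0) (i : ℕ) :
    1 - q * x * q ^ i ≠ 0 := by
  simpa only [pow_succ', mul_assoc, mul_left_comm] using h (i + 1) i.succ_pos

theorem kernelRatio_diag (a u q : ℂ) (J M : ℕ) :
    kernelRatio a u q (J + M) J =
      qPoch q q (J + M) / qPoch q q M * qPoch (u * a * q ^ (J + M)) q J *
        (qPoch u q M * (qPoch (q * a) q J * qPoch (q * a * q ^ J) q M)) /
          (qPoch u q J * qPoch (u * q ^ J) q M *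
            (qPoch (q * a) q (2 * J) * qPoch (q * a * q ^ (2 * J)) q M)) := by
  rw [kernelRatio, Nat.add_sub_cancel_left, mul_comm a q, add_right_comm, ← two_mul, qPoch_add u,
    qPoch_add (q * a), qPoch_add (q * a)]
  ring

section WP

variable {a k z q : ℂ}

theorem WPAdmissible.qk_ne_zero (h : WPAdmissible a k z q) (i : ℕ) : 1 - q * k * q ^ i ≠ 0 :=
  one_sub_base_mul_ne_zero (fun n _ => h.one_sub_k_ne_zero n) i

theorem WPAdmissible.qa_ne_zero (h : WPAdmissible a k z q) (i : ℕ) : 1 - q * a * q ^ i ≠ 0 :=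
  one_sub_base_mul_ne_zero h.one_sub_a_ne_zero i

theorem WPAdmissible.qk_div_ne_zero (h : WPAdmissible a k z q) (i : ℕ) :
    1 - q * k / z * q ^ i ≠ 0 :=
  mul_div_assoc q k z ▸ one_sub_base_mul_ne_zero h.one_sub_k_div_ne_zero i

theorem WPAdmissible.qa_div_ne_zero (h : WPAdmissible a k z q) (i : ℕ) :
    1 - q * a / z * q ^ i ≠ 0 :=
  mul_div_assoc q a z ▸ one_sub_base_mul_ne_zero h.one_sub_a_div_ne_zero i

theorem WPAdmissible.jackson (h : WPAdmissible a k z q) (J : ℕ) :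
    JacksonAdmissible (k * q ^ (2 * J)) (k / a) (q ^ J) (z * q ^ J) (q * a / z) q := by
  have ha := h.a_ne_zero
  have hz := h.z_ne_zero
  refine ⟨by field_simp; ring, one_sub_mul_pow_ne_zero h.norm_lt_one, fun i => ?_,
    h.qa_div_ne_zero, fun i => ?_, fun i => ?_, fun i => ?_⟩
  · convert h.qk_ne_zero (2 * J + i) using 2; ring
  · convert h.qk_div_ne_zero (J + i) using 2; field_simp; ring
  · convert h.qk_ne_zero (J + i) using 2; field_simp; ring
  · convert h.qa_ne_zero (2 * J + i) using 2; field_simp; ring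

theorem betaWeight_mul_wpKernel_zero (ha : a ≠ 0) (hz : z ≠ 0) (hk : 1 - k ≠ 0) (m : ℕ) :
    betaWeight a k z q (m + 1) * wpKernel a k q (m + 1) 0 =
      (1 - k * q ^ (2 * (m + 1))) * jacksonCoeff k (k / a) 1 z (q * a / z) q m := by
  have hcd : 1 * z * (q * a / z) = a * q := by field_simp
  have hbd : k / a * z * (q * a / z) = q * k := by field_simp
  have hbc : k / a * 1 * (q * a / z) = q * k / z := by field_simp
  have hcancel : qPoch k q (m + 1) / (1 - k) = qPoch (k * q) q m := by
    rw [qPoch_succ', mul_div_cancel_left₀ _ hk]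
  rw [betaWeight, wpKernel, jacksonCoeff, hcd, hbd, hbc, one_mul, ← hcancel, Nat.sub_zero,
    add_zero, Nat.add_sub_cancel]
  simp only [div_eq_mul_inv, mul_inv]
  ring

theorem betaWeight_mul_wpKernel_add (ha : a ≠ 0) (hz : z ≠ 0) (j m : ℕ) :
    betaWeight a k z q (j + 1 + (m + 1)) * wpKernel a k q (j + 1 + (m + 1)) (j + 1) =
      betaWeight a k z q (j + 1) * wpKernel a k q (j + 1) (j + 1) * (1 - q ^ (j + 1)) *
        ((1 - k * q ^ (2 * (j + 1)) * q ^ (2 * (m + 1))) *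
          jacksonCoeff (k * q ^ (2 * (j + 1))) (k / a) (q ^ (j + 1)) (z * q ^ (j + 1))
            (q * a / z) q m) := by
  have hcd : q ^ (j + 1) * (z * q ^ (j + 1)) * (q * a / z) = a * q * q ^ (2 * (j + 1)) := by
    field_simp; ring
  have hbd : k / a * (z * q ^ (j + 1)) * (q * a / z) = q * k * q ^ (j + 1) := by field_simp
  have hbc : k / a * q ^ (j + 1) * (q * a / z) = q * k / z * q ^ (j + 1) := by field_simp
  have hq : qPoch q q (j + 1 + (m + 1) - 1) =
      qPoch q q j * (1 - q ^ (j + 1)) * qPoch (q ^ (j + 1) * q) q m := by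
    rw [← add_assoc, Nat.add_sub_cancel, qPoch_add, qPoch_succ, ← pow_succ', ← pow_succ',
      ← pow_succ]
  have hk : qPoch k q (j + 1 + (m + 1) + (j + 1)) = qPoch k q (2 * (j + 1)) *
      ((1 - k * q ^ (2 * (j + 1))) * qPoch (k * q ^ (2 * (j + 1)) * q) q m) := by
    rw [← qPoch_succ', ← qPoch_add]; congr 1; ring
  rw [betaWeight, betaWeight, wpKernel, wpKernel, jacksonCoeff, hcd, hbd, hbc, hq, hk,
    show j + 1 + (m + 1) + (j + 1) = 2 * (j + 1) + (m + 1) by ring, ← two_mul,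
    Nat.add_sub_cancel_left, Nat.sub_self, Nat.add_sub_cancel, qPoch_zero, qPoch_zero,
    qPoch_add z, qPoch_add (q * k), qPoch_add (q * k / z), qPoch_add (a * q)]
  generalize 1 - k = x
  ring

theorem kernelRatio_add {u : ℂ} (hq : ∀ i, 1 - q * q ^ i ≠ 0) (hu : ∀ i, 1 - u * q ^ i ≠ 0)
    (haq : ∀ i, 1 - a * q * q ^ i ≠ 0) (J M n : ℕ) :
    kernelRatio a u q (J + M) (J + n) =
      kernelRatio a u q (J + M) J * kernelRatio (a * q ^ (2 * J)) u q M n := by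
  have hq_M := qPoch_ne_zero hq M
  have hu_M := qPoch_ne_zero hu M
  have haq_M := qPoch_ne_zero (one_sub_shift_ne_zero haq (2 * J)) M
  have hbase : a * q ^ (2 * J) * q = a * q * q ^ (2 * J) := by ring
  have hshift : u * (a * q ^ (2 * J)) * q ^ M = u * a * q ^ (J + M) * q ^ J := by ring
  rw [kernelRatio, kernelRatio, kernelRatio, Nat.add_sub_add_left, Nat.add_sub_cancel_left,
    qPoch_add _ _ J n, show J + M + (J + n) = 2 * J + (M + n) by ring,
    show J + M + J = 2 * J + M by ring, qPoch_add (a * q) q (2 * J), qPoch_add (a * q) q (2 * J),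
    hbase, hshift]
  field_simp

theorem betaWeight_mul_wpKernel_mul_kernelRatio_zero (ha : a ≠ 0) (hz : z ≠ 0) (hk : 1 - k ≠ 0)
    (N m : ℕ) :
    betaWeight a k z q (m + 1) * wpKernel a k q (m + 1) 0 *
        kernelRatio k (q * a / z) q N (m + 1) =
      jacksonTerm k (k / a) 1 z (q * a / z) q N m := by
  rw [betaWeight_mul_wpKernel_zero ha hz hk, jacksonTerm]

theorem betaWeight_mul_wpKernel_mul_kernelRatio_add (h : WPAdmissible a k z q) (j M m : ℕ) :
    betaWeight a k z q (j + 1 + (m + 1)) * wpKernel a k q (j + 1 + (m + 1)) (j + 1) *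
        kernelRatio k (q * a / z) q (j + 1 + M) (j + 1 + (m + 1)) =
      betaWeight a k z q (j + 1) * wpKernel a k q (j + 1) (j + 1) *
        kernelRatio k (q * a / z) q (j + 1 + M) (j + 1) * ((1 - q ^ (j + 1)) *
          jacksonTerm (k * q ^ (2 * (j + 1))) (k / a) (q ^ (j + 1)) (z * q ^ (j + 1))
            (q * a / z) q M m) := by
  rw [betaWeight_mul_wpKernel_add h.a_ne_zero h.z_ne_zero, jacksonTerm,
    kernelRatio_add (one_sub_mul_pow_ne_zero h.norm_lt_one) h.qa_div_ne_zero
      fun i => by simpa only [mul_comm k q] using h.qk_ne_zero i]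
  ring

theorem one_add_mul_sum_jacksonTerm_shift (h : WPAdmissible a k z q) (J M : ℕ) :
    1 + (1 - q ^ J) * ∑ m ∈ Finset.range M,
        jacksonTerm (k * q ^ (2 * J)) (k / a) (q ^ J) (z * q ^ J) (q * a / z) q M m =
      qPoch (q * k * q ^ (2 * J)) q M * qPoch (q * k / z) q M * qPoch (q * a / z * q ^ J) q M *
          qPoch (q * a * q ^ J) q M /
        (qPoch (q * a / z) q M * qPoch (q * k / z * q ^ J) q M * qPoch (q * k * q ^ J) q M *
          qPoch (q * a * q ^ (2 * J)) q M) := by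
  have ha := h.a_ne_zero
  have hz := h.z_ne_zero
  have hbcdu : k / a * q ^ J * (z * q ^ J) * (q * a / z) = q * k * q ^ (2 * J) := by
    field_simp; ring
  have hbu : k / a * (q * a / z) = q * k / z := by field_simp
  have hdu : z * q ^ J * (q * a / z) = q * a * q ^ J := by field_simp
  have hbcu : k / a * q ^ J * (q * a / z) = q * k / z * q ^ J := by field_simp
  have hbdu : k / a * (z * q ^ J) * (q * a / z) = q * k * q ^ J := by field_simp
  have hcdu : q ^ J * (z * q ^ J) * (q * a / z) = q * a * q ^ (2 * J) := by field_simp; ring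
  rw [one_add_mul_sum_jacksonTerm (h.jackson J) M, hbcdu, hbu, hdu, hbcu, hbdu, hcdu,
    mul_comm (q ^ J)]

theorem betaWeight_mul_wpKernel_self (hk₀ : 1 - k ≠ 0) (J : ℕ) :
    betaWeight a k z q J * wpKernel a k q J J =
      qPoch z q J * qPoch q q (J - 1) * (q * a / z) ^ J * qPoch (q * k) q (2 * J) /
        (qPoch (q * k) q J * qPoch (q * k / z) q J * qPoch (q * a) q (2 * J)) := by
  have hk : (1 - k * q ^ (2 * J)) * qPoch k q (2 * J) / (1 - k) = qPoch (q * k) q (2 * J) := by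
    rw [div_eq_iff hk₀, mul_comm, ← qPoch_succ, qPoch_succ', mul_comm, mul_comm k q]
  rw [betaWeight, wpKernel, Nat.sub_self, qPoch_zero, qPoch_zero, ← hk, mul_comm a q, two_mul]
  simp only [div_eq_mul_inv, mul_inv]
  ring

theorem betaWeight_mul_wpKernel_self_mul_kernelRatio (h : WPAdmissible a k z q) (J M : ℕ) :
    betaWeight a k z q J * wpKernel a k q J J * kernelRatio k (q * a / z) q (J + M) J *
        (1 + (1 - q ^ J) * ∑ m ∈ Finset.range M,
          jacksonTerm (k * q ^ (2 * J)) (k / a) (q ^ J) (z * q ^ J) (q * a / z) q M m) =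
      alphaWeight a z q J * kernelRatio a (q * k / z) q (J + M) J := by
  have hk₀ : 1 - k ≠ 0 := by simpa using h.one_sub_k_ne_zero 0
  have hqk := qPoch_ne_zero h.qk_ne_zero
  have hqk_shift := fun n => qPoch_ne_zero (one_sub_shift_ne_zero h.qk_ne_zero n) M
  have hqa := qPoch_ne_zero h.qa_ne_zero J
  have hqa_div := qPoch_ne_zero h.qa_div_ne_zero M
  have hqa_div_shift := qPoch_ne_zero (one_sub_shift_ne_zero h.qa_div_ne_zero J) M
  have hcomm : q * k / z * a * q ^ (J + M) = q * a / z * k * q ^ (J + M) := by ring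
  have hne := mul_ne_zero (mul_ne_zero (mul_ne_zero (hqk J) (hqk (2 * J)))
    (mul_ne_zero (hqk_shift J) (hqk_shift (2 * J)))) (mul_ne_zero hqa_div hqa_div_shift)
  rw [one_add_mul_sum_jacksonTerm_shift h J M, betaWeight_mul_wpKernel_self hk₀, alphaWeight,
    kernelRatio_diag, kernelRatio_diag, hcomm, div_mul_eq_mul_div _ _ ((q * a / z) ^ J),
    div_mul_div_comm, div_mul_div_comm, div_mul_div_comm, ← mul_div_mul_right _ _ hqa]
  rw [← mul_div_mul_right (qPoch z q J * _ * _ * (_ * _ * _)) _ hne]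
  congr 1 <;> ring

theorem sum_betaWeight_mul_wpKernel_mul_kernelRatio (h : WPAdmissible a k z q) (j M : ℕ) :
    ∑ m ∈ Finset.range (M + 1), betaWeight a k z q (j + 1 + m) *
        wpKernel a k q (j + 1 + m) (j + 1) *
          kernelRatio k (q * a / z) q (j + 1 + M) (j + 1 + m) =
      alphaWeight a z q (j + 1) * kernelRatio a (q * k / z) q (j + 1 + M) (j + 1) := by
  rw [← betaWeight_mul_wpKernel_self_mul_kernelRatio h, mul_add, mul_one, Finset.sum_range_succ',
    add_comm, Finset.mul_sum, Finset.mul_sum]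
  congr 1
  exact Finset.sum_congr rfl fun m _ => betaWeight_mul_wpKernel_mul_kernelRatio_add h j M m

theorem sum_betaWeight_mul_wpKernel_zero_mul_kernelRatio (h : WPAdmissible a k z q) (N : ℕ) :
    ∑ m ∈ Finset.range N, betaWeight a k z q (m + 1) * wpKernel a k q (m + 1) 0 *
        kernelRatio k (q * a / z) q N (m + 1) =
      ∑ i ∈ Finset.range N, (lambertTerm (q * a / z) q i + lambertTerm (q * k) q i -
        lambertTerm (q * k / z) q i - lambertTerm (q * a) q i) := by
  have ha := h.a_ne_zero
  have hz := h.z_ne_zero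
  have hbdu : k / a * z * (q * a / z) = q * k := by field_simp
  have hbu : k / a * (q * a / z) = q * k / z := by field_simp
  have hdu : z * (q * a / z) = q * a := by field_simp
  have hlambert := sum_jacksonTerm_one (by simpa using h.jackson 0) N
  rw [hbdu, hbu, hdu] at hlambert
  rw [← hlambert]
  exact Finset.sum_congr rfl fun m _ => betaWeight_mul_wpKernel_mul_kernelRatio_zero
    ha hz (by simpa using h.one_sub_k_ne_zero 0) N m

variable {α β : ℕ → ℂ}

theorem IsWPBaileyPair.succ (hp : IsWPBaileyPair a k q α β) (n : ℕ) :
    β (n + 1) = wpKernel a k q (n + 1) 0 +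
      ∑ j ∈ Finset.range (n + 1), wpKernel a k q (n + 1) (j + 1) * α (j + 1) := by
  rw [hp.2.2 _ n.succ_pos, Finset.sum_range_succ', hp.1, mul_one, add_comm]
  rfl

theorem sum_kernelRatio_mul_betaTerm (h : WPAdmissible a k z q) (hp : IsWPBaileyPair a k q α β)
    (N : ℕ) :
    ∑ n ∈ Finset.range N, kernelRatio k (q * a / z) q N (n + 1) * betaTerm a k z q β (n + 1) =
      ∑ n ∈ Finset.range N, kernelRatio a (q * k / z) q N (n + 1) * alphaTerm a z q α (n + 1) +
        ∑ i ∈ Finset.range N, (lambertTerm (q * a / z) q i + lambertTerm (q * k) q i -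
          lambertTerm (q * k / z) q i - lambertTerm (q * a) q i) := by
  have hβ (n : ℕ) : kernelRatio k (q * a / z) q N (n + 1) * betaTerm a k z q β (n + 1) =
      betaWeight a k z q (n + 1) * wpKernel a k q (n + 1) 0 *
          kernelRatio k (q * a / z) q N (n + 1) +
        ∑ j ∈ Finset.range (n + 1), betaWeight a k z q (n + 1) * wpKernel a k q (n + 1) (j + 1) *
          kernelRatio k (q * a / z) q N (n + 1) * α (j + 1) := by
    rw [betaTerm, ← betaWeight, hp.succ, mul_add, mul_add, Finset.mul_sum, Finset.mul_sum]
    congr 1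
    · ring
    · exact Finset.sum_congr rfl fun j _ => by ring
  simp only [hβ, Finset.sum_add_distrib]
  rw [sum_betaWeight_mul_wpKernel_zero_mul_kernelRatio h, add_comm]
  congr 1
  simp only [Finset.range_eq_Ico]
  rw [← Finset.sum_Ico_Ico_comm]
  refine Finset.sum_congr rfl fun j hj => ?_
  obtain ⟨M, rfl⟩ := Nat.exists_eq_add_of_le (Nat.succ_le_of_lt (Finset.mem_Ico.1 hj).2)
  rw [alphaTerm, ← alphaWeight, ← mul_assoc, mul_comm (kernelRatio _ _ _ _ _),
    ← sum_betaWeight_mul_wpKernel_mul_kernelRatio h, Finset.sum_mul, Finset.sum_Ico_eq_sum_range,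
    show j.succ + M - j = M + 1 by omega]
  simp only [Nat.succ_eq_add_one, add_right_comm j _ 1]

end WP

theorem norm_qPoch_le {x q : ℂ} {R : ℝ} (hq : ‖q‖ < 1) (hx : ‖x‖ ≤ R) (n : ℕ) :
    ‖qPoch x q n‖ ≤ Real.exp (R * (1 - ‖q‖)⁻¹) := by
  have hR : 0 ≤ R := (norm_nonneg x).trans hx
  have hsum : ∑ i ∈ Finset.range n, ‖-(x * q ^ i)‖ ≤ R * (1 - ‖q‖)⁻¹ := by
    simp only [norm_neg, norm_mul, norm_pow, ← Finset.mul_sum]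
    rw [← tsum_geometric_of_lt_one (norm_nonneg q) hq]
    gcongr
    exact (summable_geometric_of_lt_one (norm_nonneg q) hq).sum_le_tsum _ fun _ _ => by positivity
  have hprod := (Finset.range n).norm_prod_one_add_sub_one_le fun i => -(x * q ^ i)
  simp only [← sub_eq_add_neg] at hprod
  rw [← qPoch] at hprod
  have htriangle := norm_le_norm_add_norm_sub' (qPoch x q n) 1
  rw [norm_one] at htriangle
  linarith [Real.exp_le_exp.2 hsum]

/-- The infinite `q`-shifted factorial `(x; q)_∞`. -/
noncomputable def qPochInf (x q : ℂ) : ℂ :=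
  ∏' i : ℕ, (1 - x * q ^ i)

theorem summable_norm_mul_pow {K : Type*} [NormedDivisionRing K] {q : K} (hq : ‖q‖ < 1) (x : K) :
    Summable fun i : ℕ => ‖x * q ^ i‖ := by
  simpa only [norm_mul, norm_pow] using
    (summable_geometric_of_lt_one (norm_nonneg q) hq).mul_left ‖x‖

theorem tendsto_qPoch {q : ℂ} (hq : ‖q‖ < 1) (x : ℂ) :
    Tendsto (qPoch x q) atTop (𝓝 (qPochInf x q)) := by
  have h := (multipliable_one_add_of_summable (f := fun i : ℕ => -(x * q ^ i))
    (by simpa only [norm_neg] using summable_norm_mul_pow hq x)).hasProd.tendsto_prod_nat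
  simp only [← sub_eq_add_neg] at h
  exact h

theorem qPochInf_ne_zero {x q : ℂ} (hq : ‖q‖ < 1) (h : ∀ i : ℕ, 1 - x * q ^ i ≠ 0) :
    qPochInf x q ≠ 0 := by
  have hne := tprod_one_add_ne_zero_of_summable (f := fun i : ℕ => -(x * q ^ i))
    (by simpa only [← sub_eq_add_neg] using h)
    (by simpa only [norm_neg] using summable_norm_mul_pow hq x)
  simp only [← sub_eq_add_neg] at hne
  exact hne

theorem exists_norm_inv_qPoch_le {x q : ℂ} (hq : ‖q‖ < 1) (h : ∀ i : ℕ, 1 - x * q ^ i ≠ 0) :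
    ∃ C, ∀ n, ‖(qPoch x q n)⁻¹‖ ≤ C := by
  obtain ⟨C, hC⟩ := ((tendsto_qPoch hq x).inv₀ (qPochInf_ne_zero hq h)).norm.bddAbove_range
  exact ⟨C, fun n => hC ⟨n, rfl⟩⟩

theorem tendsto_mul_pow {R : Type*} [NormedRing R] {q : R} (hq : ‖q‖ < 1) (x : R) :
    Tendsto (fun n => x * q ^ n) atTop (𝓝 0) := by
  simpa only [mul_zero] using (tendsto_pow_atTop_nhds_zero_of_norm_lt_one hq).const_mul x

theorem tendsto_qPoch_mul_pow {q : ℂ} (hq : ‖q‖ < 1) (x : ℂ) (n : ℕ) :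
    Tendsto (fun N => qPoch (x * q ^ N) q n) atTop (𝓝 1) := by
  have hcont : Continuous fun y => qPoch y q n := by unfold qPoch; fun_prop
  have hlim := (hcont.tendsto 0).comp (tendsto_mul_pow hq x)
  rwa [qPoch, Finset.prod_eq_one fun i _ => by rw [zero_mul, sub_zero]] at hlim

section KernelRatio

variable {a u q : ℂ}

theorem tendsto_kernelRatio (hq : ‖q‖ < 1) (hu : ∀ i, 1 - u * q ^ i ≠ 0)
    (haq : ∀ i, 1 - q * a * q ^ i ≠ 0) (n : ℕ) :
    Tendsto (fun N => kernelRatio a u q N n) atTop (𝓝 1) := by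
  rw [mul_comm] at haq
  have hQ := qPochInf_ne_zero hq (one_sub_mul_pow_ne_zero hq)
  have hU := qPochInf_ne_zero hq hu
  have hA := qPochInf_ne_zero hq haq
  have hsub := tendsto_sub_atTop_nat n
  have hadd := tendsto_add_atTop_nat n
  have hlim := ((((tendsto_qPoch hq q).mul ((tendsto_qPoch hq u).comp hsub)).mul
    (tendsto_qPoch hq (a * q))).mul (tendsto_qPoch_mul_pow hq (u * a) n)).div
      ((((tendsto_qPoch hq q).comp hsub).mul (tendsto_qPoch hq u)).mul
        ((tendsto_qPoch hq (a * q)).comp hadd)) (mul_ne_zero (mul_ne_zero hQ hU) hA)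
  rwa [mul_one, div_self (mul_ne_zero (mul_ne_zero hQ hU) hA)] at hlim

theorem exists_norm_kernelRatio_le (hq : ‖q‖ < 1) (hu : ∀ i, 1 - u * q ^ i ≠ 0)
    (haq : ∀ i, 1 - q * a * q ^ i ≠ 0) : ∃ C, ∀ N n, ‖kernelRatio a u q N n‖ ≤ C := by
  rw [mul_comm] at haq
  obtain ⟨Q, hQ⟩ := exists_norm_inv_qPoch_le hq (one_sub_mul_pow_ne_zero hq)
  obtain ⟨U, hU⟩ := exists_norm_inv_qPoch_le hq hu
  obtain ⟨A, hA⟩ := exists_norm_inv_qPoch_le hq haq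
  have hQ₀ := (norm_nonneg _).trans (hQ 0)
  have hU₀ := (norm_nonneg _).trans (hU 0)
  have hnorm (N : ℕ) : ‖u * a * q ^ N‖ ≤ ‖u * a‖ := by
    rw [norm_mul, norm_pow]
    exact mul_le_of_le_one_right (norm_nonneg _) (pow_le_one₀ (norm_nonneg q) hq.le)
  refine ⟨Real.exp (‖q‖ * (1 - ‖q‖)⁻¹) * Real.exp (‖u‖ * (1 - ‖q‖)⁻¹) *
    Real.exp (‖a * q‖ * (1 - ‖q‖)⁻¹) * Real.exp (‖u * a‖ * (1 - ‖q‖)⁻¹) * (Q * U * A),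
    fun N n => ?_⟩
  rw [kernelRatio, div_eq_mul_inv, mul_inv, mul_inv]
  iterate 6 rw [norm_mul]
  gcongr
  exacts [norm_qPoch_le hq le_rfl _, norm_qPoch_le hq le_rfl _, norm_qPoch_le hq le_rfl _,
    norm_qPoch_le hq (hnorm N) _, hQ _, hU _, hA _]

end KernelRatio

theorem tendsto_sum_range_mul_of_summable_norm {R : Type*} [NormedRing R] [CompleteSpace R]
    {f : ℕ → R} (hf : Summable fun n => ‖f n‖) {w : ℕ → ℕ → R} {C : ℝ}
    (hw : ∀ N n, ‖w N n‖ ≤ C) (hlim : ∀ n, Tendsto (fun N => w N n) atTop (𝓝 1)) :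
    Tendsto (fun N => ∑ n ∈ Finset.range N, w N n * f n) atTop (𝓝 (∑' n, f n)) := by
  have hsum (N : ℕ) : ∑ n ∈ Finset.range N, w N n * f n =
      ∑' n, (Finset.range N : Set ℕ).indicator (fun n => w N n * f n) n :=
    sum_eq_tsum_indicator _ _
  simp only [hsum]
  refine tendsto_tsum_of_dominated_convergence (hf.mul_left C) (fun n => ?_)
    (.of_forall fun N n => (norm_indicator_le_norm_self _ _).trans ((norm_mul_le _ _).trans
      (mul_le_mul_of_nonneg_right (hw N n) (norm_nonneg _))))
  have hn : ∀ᶠ N in atTop, w N n * f n =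
      (Finset.range N : Set ℕ).indicator (fun n => w N n * f n) n := by
    filter_upwards [eventually_gt_atTop n] with N hN
    rw [Set.indicator_of_mem (Finset.mem_coe.2 (Finset.mem_range.2 hN))]
  simpa only [one_mul] using ((hlim n).mul_const (f n)).congr' hn

/-- The Lambert series `∑ x q ^ i / (1 - x q ^ i)`. -/
noncomputable def lambert (x q : ℂ) : ℂ :=
  ∑' i, lambertTerm x q i

theorem summable_lambertTerm {q : ℂ} (hq : ‖q‖ < 1) (x : ℂ) : Summable (lambertTerm x q) := by
  have hlim := ((tendsto_mul_pow hq x).const_sub 1).inv₀ (by simp)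
  exact (summable_norm_mul_pow hq x).mul_tendsto_const (Nat.cofinite_eq_atTop ▸ hlim)

theorem lambert_add_lambert_neg {x q : ℂ} (hq : ‖q‖ < 1) (h : ∀ i : ℕ, 1 - x * q ^ i ≠ 0)
    (h' : ∀ i : ℕ, 1 - -x * q ^ i ≠ 0) :
    lambert x q + lambert (-x) q = 2 * lambert (x ^ 2) (q ^ 2) := by
  rw [lambert, lambert, lambert, ← tsum_mul_left,
    ← (summable_lambertTerm hq x).tsum_add (summable_lambertTerm hq (-x))]
  refine tsum_congr fun i => ?_
  have hfactor : 1 - x ^ 2 * (q ^ 2) ^ i = (1 - x * q ^ i) * (1 - -x * q ^ i) := by ring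
  have hi := h i
  have hi' := h' i
  rw [lambertTerm, lambertTerm, lambertTerm, hfactor, div_add_div _ _ hi hi', mul_div_assoc']
  congr 1
  ring

/-- The contribution of `α 0 = β 0 = 1` to the difference between the `β`-weighted and the
`α`-weighted series. -/
noncomputable def lambertCorrection (a k z q : ℂ) : ℂ :=
  lambert (q * a / z) q + lambert (q * k) q - lambert (q * k / z) q - lambert (q * a) q

theorem tsum_betaTerm_eq {a k z q : ℂ} {α β : ℕ → ℂ} (h : WPAdmissible a k z q)
    (hp : IsWPBaileyPair a k q α β) (hβ : Summable fun n => betaTerm a k z q β (n + 1))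
    (hα : Summable fun n => alphaTerm a z q α (n + 1)) :
    ∑' n, betaTerm a k z q β (n + 1) =
      ∑' n, alphaTerm a z q α (n + 1) + lambertCorrection a k z q := by
  have hq := h.norm_lt_one
  obtain ⟨B, hB⟩ := exists_norm_kernelRatio_le hq h.qa_div_ne_zero h.qk_ne_zero
  obtain ⟨A, hA⟩ := exists_norm_kernelRatio_le hq h.qk_div_ne_zero h.qa_ne_zero
  have hβ_lim := tendsto_sum_range_mul_of_summable_norm hβ.norm (fun N n => hB N (n + 1))
    fun n => tendsto_kernelRatio hq h.qa_div_ne_zero h.qk_ne_zero (n + 1)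
  have hα_lim := tendsto_sum_range_mul_of_summable_norm hα.norm (fun N n => hA N (n + 1))
    fun n => tendsto_kernelRatio hq h.qk_div_ne_zero h.qa_ne_zero (n + 1)
  have hlambert (x : ℂ) : HasSum (lambertTerm x q) (lambert x q) :=
    (summable_lambertTerm hq x).hasSum
  have hcorr := ((((hlambert (q * a / z)).add (hlambert (q * k))).sub
    (hlambert (q * k / z))).sub (hlambert (q * a))).tendsto_sum_nat
  refine tendsto_nhds_unique hβ_lim ?_
  simpa only [sum_kernelRatio_mul_betaTerm h hp, lambertCorrection] using hα_lim.add hcorr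

theorem WPAdmissible.sq {a k z q : ℂ} (h : WPAdmissible a k z q)
    (h' : WPAdmissible (-a) (-k) z q) : WPAdmissible (a ^ 2) (k ^ 2) (z ^ 2) (q ^ 2) := by
  have hmul {x : ℂ} {n : ℕ} (hx : 1 - x * q ^ n ≠ 0) (hx' : 1 - -x * q ^ n ≠ 0) :
      1 - x ^ 2 * (q ^ 2) ^ n ≠ 0 := by
    convert mul_ne_zero hx hx' using 1
    ring
  refine ⟨?_, pow_ne_zero 2 h.a_ne_zero, pow_ne_zero 2 h.z_ne_zero,
    fun n => hmul (h.one_sub_k_ne_zero n) (h'.one_sub_k_ne_zero n),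
    fun n hn => hmul (h.one_sub_a_ne_zero n hn) (h'.one_sub_a_ne_zero n hn),
    fun n hn => ?_, fun n hn => ?_⟩
  · rw [norm_pow]
    exact pow_lt_one₀ (norm_nonneg q) h.norm_lt_one two_ne_zero
  · rw [← div_pow]
    exact hmul (h.one_sub_k_div_ne_zero n hn) (neg_div z k ▸ h'.one_sub_k_div_ne_zero n hn)
  · rw [← div_pow]
    exact hmul (h.one_sub_a_div_ne_zero n hn) (neg_div z a ▸ h'.one_sub_a_div_ne_zero n hn)

theorem lambertCorrection_add_lambertCorrection_neg {a k z q : ℂ} (h : WPAdmissible a k z q)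
    (h' : WPAdmissible (-a) (-k) z q) :
    lambertCorrection a k z q + lambertCorrection (-a) (-k) z q =
      2 * lambertCorrection (a ^ 2) (k ^ 2) (z ^ 2) (q ^ 2) := by
  have hneg (x : ℂ) : q * -x / z = -(q * x / z) := by rw [mul_neg, neg_div]
  simp only [lambertCorrection, mul_neg, neg_div, ← mul_pow, ← div_pow]
  have hq := h.norm_lt_one
  have h_a := lambert_add_lambert_neg hq h.qa_ne_zero fun i => mul_neg q a ▸ h'.qa_ne_zero i
  have h_k := lambert_add_lambert_neg hq h.qk_ne_zero fun i => mul_neg q k ▸ h'.qk_ne_zero i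
  have h_a_div := lambert_add_lambert_neg hq h.qa_div_ne_zero fun i => hneg a ▸ h'.qa_div_ne_zero i
  have h_k_div := lambert_add_lambert_neg hq h.qk_div_ne_zero fun i => hneg k ▸ h'.qk_div_ne_zero i
  linear_combination h_a_div + h_k - h_k_div - h_a

theorem theorem2
    (a k z q : ℂ) (hq : ‖q‖ < 1) (ha : a ≠ 0) (hz : z ≠ 0)
    -- none of the denominators vanishes
    (hk : ∀ n : ℕ, 1 - k * q ^ n ≠ 0 ∧ 1 + k * q ^ n ≠ 0)
    (haq : ∀ n : ℕ, 1 ≤ n → 1 - a * q ^ n ≠ 0 ∧ 1 + a * q ^ n ≠ 0)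
    (hkz : ∀ n : ℕ, 1 ≤ n → 1 - k / z * q ^ n ≠ 0 ∧ 1 + k / z * q ^ n ≠ 0)
    (haz : ∀ n : ℕ, 1 ≤ n → 1 - a / z * q ^ n ≠ 0 ∧ 1 + a / z * q ^ n ≠ 0)
    -- `α a k q n` stands for `α_n(a, k, q)`, and similarly for `β`
    (α β : ℂ → ℂ → ℂ → ℕ → ℂ)
    (h₁ : IsWPBaileyPair a k q (α a k q) (β a k q))
    (h₂ : IsWPBaileyPair (-a) (-k) q (α (-a) (-k) q) (β (-a) (-k) q))
    (h₃ : IsWPBaileyPair (a ^ 2) (k ^ 2) (q ^ 2)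
      (α (a ^ 2) (k ^ 2) (q ^ 2)) (β (a ^ 2) (k ^ 2) (q ^ 2)))
    -- each of the six series converges
    (hβ₁ : Summable fun n : ℕ => betaTerm a k z q (β a k q) (n + 1))
    (hβ₂ : Summable fun n : ℕ => betaTerm (-a) (-k) z q (β (-a) (-k) q) (n + 1))
    (hβ₃ : Summable fun n : ℕ =>
      betaTerm (a ^ 2) (k ^ 2) (z ^ 2) (q ^ 2) (β (a ^ 2) (k ^ 2) (q ^ 2)) (n + 1))
    (hα₁ : Summable fun n : ℕ => alphaTerm a z q (α a k q) (n + 1))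
    (hα₂ : Summable fun n : ℕ => alphaTerm (-a) z q (α (-a) (-k) q) (n + 1))
    (hα₃ : Summable fun n : ℕ =>
      alphaTerm (a ^ 2) (z ^ 2) (q ^ 2) (α (a ^ 2) (k ^ 2) (q ^ 2)) (n + 1)) :
    (∑' n : ℕ, betaTerm a k z q (β a k q) (n + 1))
      + (∑' n : ℕ, betaTerm (-a) (-k) z q (β (-a) (-k) q) (n + 1))
      - 2 * (∑' n : ℕ,
          betaTerm (a ^ 2) (k ^ 2) (z ^ 2) (q ^ 2) (β (a ^ 2) (k ^ 2) (q ^ 2)) (n + 1))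
    = (∑' n : ℕ, alphaTerm a z q (α a k q) (n + 1))
      + (∑' n : ℕ, alphaTerm (-a) z q (α (-a) (-k) q) (n + 1))
      - 2 * (∑' n : ℕ,
          alphaTerm (a ^ 2) (z ^ 2) (q ^ 2) (α (a ^ 2) (k ^ 2) (q ^ 2)) (n + 1)) := by
  have h : WPAdmissible a k z q := ⟨hq, ha, hz, fun n => (hk n).1, fun n hn => (haq n hn).1,
    fun n hn => (hkz n hn).1, fun n hn => (haz n hn).1⟩
  have h' : WPAdmissible (-a) (-k) z q := by
    refine ⟨hq, neg_ne_zero.2 ha, hz, fun n => ?_, fun n hn => ?_, fun n hn => ?_, fun n hn => ?_⟩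
    · simpa using (hk n).2
    · simpa using (haq n hn).2
    · simpa [neg_div] using (hkz n hn).2
    · simpa [neg_div] using (haz n hn).2
  rw [tsum_betaTerm_eq h h₁ hβ₁ hα₁, tsum_betaTerm_eq h' h₂ hβ₂ hα₂,
    tsum_betaTerm_eq (h.sq h') h₃ hβ₃ hα₃]
  linear_combination lambertCorrection_add_lambertCorrection_neg h h'
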